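/- For a metric space $M$ with a distinguished point $0$, let $\mathrm{Lip}_0(M)$ be the Banach space of Lipschitz functions $f\colon M\to\mathbb R$ with $f(0)=0$, normed by the best Lipschitz constant; if $M$ is bounded, it is a (non-unital) real algebra under pointwise multiplication. For an ultrafilter $\mathcal U$ on a set $I$ and metric spaces $(M_i,d_i)_{i\in I}$ with distinguished points $0_i\in M_i$, the ultraproduct $(M_i)_{\mathcal U}$ is the quotient of $\{(x_i)\in\prod_{i\in I} M_i:\sup_i d_i(x_i,0_i)<\infty\}$ that identifies points at distance $0$ for the pseudometric $d((x_i),(y_i))=\lim_{\mathcal U}d_i(x_i,y_i)$, with the induced metric; the ultraproduct of normed spaces is formed with $0_i=0$ and is a normed space with the coordinatewise operations. If the $M_i$ are uniformly bounded (that is, $\sup_i\operatorname{diam}M_i<\infty$), then $(\mathrm{Lip}_0(M_i))_{\mathcal U}$ is an algebra under the product $(f_i)_{\mathcal U}(g_i)_{\mathcal U}=(f_ig_i)_{\mathcal U}$. **Proposition.** Let $K$ be a compact metric space with a distinguished point, let $\mathcal U$ be an ultrafilter on a set $I$, and let $(M_i)_{i\in I}$ be a uniformly bounded family of metric spaces with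 distinguished points. If there is an algebra isomorphism (a multiplicative linear bijection) between $(\mathrm{Lip}_0(M_i))_{\mathcal U}$ and $\mathrm{Lip}_0(K)$, then $(M_i)_{\mathcal U}$ is biLipschitz equivalent to a subset of $K$; that is, there are a set $S\subseteq K$ and a bijection $(M_i)_{\mathcal U}\to S$ that is Lipschitz and has a Lipschitz inverse. -/

import Mathlib

open Filter Topology
open scoped NNReal

noncomputable section

/-! ### The space `Lip₀(M)` -/

section Lip0

/-- The real-valued Lipschitz functions on `M` that vanish at the distinguished point `o`, as a
linear subspace of all functions. -/
def lip0Submodule (M : Type*) [MetricSpace M] (o : M) : Submodule ℝ (M → ℝ) where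
  carrier := {f | f o = 0 ∧ ∃ C : ℝ≥0, LipschitzWith C f}
  zero_mem' := ⟨rfl, 0, LipschitzWith.const (0 : ℝ)⟩
  add_mem' := by
    rintro f g ⟨hf, C, hC⟩ ⟨hg, D, hD⟩
    exact ⟨by simp [hf, hg], C + D, hC.add hD⟩
  smul_mem' := by
    rintro c f ⟨hf, C, hC⟩
    refine ⟨by simp [hf], ‖c‖₊ * C, LipschitzWith.of_dist_le_mul fun x y => ?_⟩
    have h := mul_le_mul_of_nonneg_left (hC.dist_le_mul x y) (norm_nonneg c)
    simp only [Pi.smul_apply, dist_smul₀, NNReal.coe_mul, coe_nnnorm]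
    linarith

/-- `Lip₀(M)`; a type of its own, so that it carries the Lipschitz norm and no other topology. -/
def Lip0 (M : Type*) [MetricSpace M] (o : M) : Type _ := lip0Submodule M o

variable {M : Type*} [MetricSpace M] {o : M}

instance : AddCommGroup (Lip0 M o) := inferInstanceAs (AddCommGroup (lip0Submodule M o))

instance : Module ℝ (Lip0 M o) := inferInstanceAs (Module ℝ (lip0Submodule M o))

instance : FunLike (Lip0 M o) M ℝ where
  coe f := f.1
  coe_injective _ _ h := Subtype.ext h

namespace Lip0

@[ext] theorem ext {f g : Lip0 M o} (h : ∀ x, f x = g x) : f = g := DFunLike.ext _ _ h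

@[simp] theorem zero_apply (x : M) : (0 : Lip0 M o) x = 0 := rfl
@[simp] theorem add_apply (f g : Lip0 M o) (x : M) : (f + g) x = f x + g x := rfl
@[simp] theorem neg_apply (f : Lip0 M o) (x : M) : (-f) x = -f x := rfl
@[simp] theorem sub_apply (f g : Lip0 M o) (x : M) : (f - g) x = f x - g x := rfl
@[simp] theorem smul_apply (c : ℝ) (f : Lip0 M o) (x : M) : (c • f) x = c * f x := rfl
@[simp] theorem apply_base (f : Lip0 M o) : f o = 0 := f.2.1

/-- The norm of `Lip₀(M)` is the best Lipschitz constant, the supremum of the slopes. Pairs of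
equal points contribute `0 / 0 = 0`. -/
instance : Norm (Lip0 M o) where
  norm f := ⨆ p : M × M, |f p.1 - f p.2| / dist p.1 p.2

theorem norm_def (f : Lip0 M o) : ‖f‖ = ⨆ p : M × M, |f p.1 - f p.2| / dist p.1 p.2 := rfl

theorem bddAbove_slopes (f : Lip0 M o) :
    BddAbove (Set.range fun p : M × M => |f p.1 - f p.2| / dist p.1 p.2) := by
  obtain ⟨-, C, hC⟩ := f.2
  refine ⟨C, ?_⟩
  rintro _ ⟨p, rfl⟩
  exact div_le_of_le_mul₀ dist_nonneg C.2 (hC.dist_le_mul p.1 p.2)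

theorem norm_le {f : Lip0 M o} {C : ℝ} (hC : 0 ≤ C) (h : ∀ x y, |f x - f y| ≤ C * dist x y) :
    ‖f‖ ≤ C := by
  have : Nonempty (M × M) := ⟨(o, o)⟩
  exact ciSup_le fun p => div_le_of_le_mul₀ dist_nonneg hC (h p.1 p.2)

theorem norm_nonneg' (f : Lip0 M o) : 0 ≤ ‖f‖ :=
  Real.iSup_nonneg fun _ => div_nonneg (abs_nonneg _) dist_nonneg

theorem abs_sub_le (f : Lip0 M o) (x y : M) : |f x - f y| ≤ ‖f‖ * dist x y := by
  rcases eq_or_ne x y with rfl | hxy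
  · simp
  · have h : |f x - f y| / dist x y ≤ ‖f‖ := le_ciSup f.bddAbove_slopes (x, y)
    exact (div_le_iff₀ (dist_pos.2 hxy)).1 h

theorem abs_apply_le (f : Lip0 M o) (x : M) : |f x| ≤ ‖f‖ * dist x o := by
  simpa using f.abs_sub_le x o

instance : NormedAddCommGroup (Lip0 M o) :=
  AddGroupNorm.toNormedAddCommGroup
    { toFun := fun f => ‖f‖
      map_zero' := le_antisymm (norm_le le_rfl fun x y => by simp) (norm_nonneg' _)
      add_le' := fun f g => by
        refine norm_le (add_nonneg (norm_nonneg' f) (norm_nonneg' g)) fun x y => ?_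
        calc |(f + g) x - (f + g) y| = |(f x - f y) + (g x - g y)| := by
              simp only [add_apply]; congr 1; ring
          _ ≤ |f x - f y| + |g x - g y| := abs_add_le _ _
          _ ≤ (‖f‖ + ‖g‖) * dist x y := by
              linarith [f.abs_sub_le x y, g.abs_sub_le x y, add_mul ‖f‖ ‖g‖ (dist x y)]
      neg' := fun f => by
        simp only [norm_def, neg_apply, neg_sub_neg]
        exact iSup_congr fun p => by rw [abs_sub_comm]
      eq_zero_of_map_eq_zero' := fun f hf => by
        ext x
        have h := f.abs_apply_le x
        have hf' : ‖f‖ = 0 := hf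
        rw [hf', zero_mul] at h
        exact abs_eq_zero.1 (le_antisymm h (abs_nonneg _)) }

instance : NormedSpace ℝ (Lip0 M o) where
  norm_smul_le c f := norm_le (mul_nonneg (norm_nonneg _) (norm_nonneg _)) fun x y => by
    rw [smul_apply, smul_apply, ← mul_sub, abs_mul, Real.norm_eq_abs, mul_assoc]
    exact mul_le_mul_of_nonneg_left (f.abs_sub_le x y) (abs_nonneg c)

theorem abs_mul_sub_mul_le {D : ℝ} (hD : ∀ x y : M, dist x y ≤ D) (f g : Lip0 M o) (x y : M) :
    |f x * g x - f y * g y| ≤ (2 * D * ‖f‖ * ‖g‖) * dist x y := by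
  have hf : |f y| ≤ ‖f‖ * D :=
    (f.abs_apply_le y).trans (mul_le_mul_of_nonneg_left (hD _ _) (norm_nonneg _))
  have hg : |g x| ≤ ‖g‖ * D :=
    (g.abs_apply_le x).trans (mul_le_mul_of_nonneg_left (hD _ _) (norm_nonneg _))
  have hD0 : 0 ≤ D := dist_nonneg.trans (hD o o)
  calc |f x * g x - f y * g y| = |(f x - f y) * g x + f y * (g x - g y)| := by congr 1; ring
    _ ≤ |f x - f y| * |g x| + |f y| * |g x - g y| := by
        rw [← abs_mul, ← abs_mul]; exact abs_add_le _ _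
    _ ≤ (‖f‖ * dist x y) * (‖g‖ * D) + (‖f‖ * D) * (‖g‖ * dist x y) := by
        gcongr
        · exact f.abs_sub_le x y
        · exact g.abs_sub_le x y
    _ = _ := by ring

/-- The pointwise product of two elements of `Lip₀(M)`, where `M` has diameter at most `D`. -/
def mulOfBounded {D : ℝ} (hD : ∀ x y : M, dist x y ≤ D) (f g : Lip0 M o) : Lip0 M o :=
  ⟨fun x => f x * g x, by simp, ⟨2 * D * ‖f‖ * ‖g‖,
    mul_nonneg (mul_nonneg (mul_nonneg zero_le_two (dist_nonneg.trans (hD o o))) (norm_nonneg _))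
      (norm_nonneg _)⟩,
    LipschitzWith.of_dist_le_mul fun x y => abs_mul_sub_mul_le hD f g x y⟩

@[simp] theorem mulOfBounded_apply {D : ℝ} (hD : ∀ x y : M, dist x y ≤ D) (f g : Lip0 M o)
    (x : M) : mulOfBounded hD f g x = f x * g x := rfl

theorem norm_mulOfBounded_le {D : ℝ} (hD : ∀ x y : M, dist x y ≤ D) (f g : Lip0 M o) :
    ‖mulOfBounded hD f g‖ ≤ 2 * D * ‖f‖ * ‖g‖ :=
  norm_le (mul_nonneg (mul_nonneg (mul_nonneg zero_le_two (dist_nonneg.trans (hD o o)))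
    (norm_nonneg _)) (norm_nonneg _)) (abs_mul_sub_mul_le hD f g)

theorem exists_dist_le (M : Type*) [MetricSpace M] [BoundedSpace M] :
    ∃ D : ℝ, ∀ x y : M, dist x y ≤ D :=
  ⟨Metric.diam (Set.univ : Set M), fun x y =>
    Metric.dist_le_diam_of_mem (Bornology.IsBounded.all _) (Set.mem_univ x) (Set.mem_univ y)⟩

/-- For bounded `M`, `Lip₀(M)` is a (non-unital) algebra under pointwise multiplication. -/
instance [BoundedSpace M] : NonUnitalCommRing (Lip0 M o) where
  mul f g := mulOfBounded (exists_dist_le M).choose_spec f g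
  left_distrib f g h := ext fun x => mul_add (f x) (g x) (h x)
  right_distrib f g h := ext fun x => add_mul (f x) (g x) (h x)
  zero_mul f := ext fun x => zero_mul (f x)
  mul_zero f := ext fun x => mul_zero (f x)
  mul_assoc f g h := ext fun x => mul_assoc (f x) (g x) (h x)
  mul_comm f g := ext fun x => mul_comm (f x) (g x)

@[simp] theorem mul_apply [BoundedSpace M] (f g : Lip0 M o) (x : M) : (f * g) x = f x * g x := rfl

end Lip0

end Lip0

/-! ### Ultraproducts of pointed metric spaces -/

section Ultraproduct

/-- The set `ℓ_∞(M_i)` of families at bounded distance from the distinguished points. The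
ultrafilter is a parameter because it determines the pseudometric. -/
def PreUltraproduct {I : Type*} (_U : Ultrafilter I) (M : I → Type*) [∀ i, PseudoMetricSpace (M i)]
    (o : ∀ i, M i) : Type _ :=
  {x : ∀ i, M i // ∃ C : ℝ, ∀ i, dist (x i) (o i) ≤ C}

variable {I : Type*} {U : Ultrafilter I}

theorem Ultrafilter.tendsto_limUnder_of_bounded {u : I → ℝ} {C : ℝ} (h : ∀ i, |u i| ≤ C) :
    Tendsto u U (𝓝 (limUnder (U : Filter I) u)) := by
  have hmem : (U.map u : Filter ℝ) ≤ 𝓟 (Set.Icc (-C) C) := by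
    rw [le_principal_iff]
    exact Filter.mem_map.2 (Filter.univ_mem' fun i => abs_le.1 (h i))
  obtain ⟨a, -, ha⟩ := (isCompact_Icc (a := -C) (b := C)).ultrafilter_le_nhds (U.map u) hmem
  exact tendsto_nhds_limUnder ⟨a, ha⟩

namespace PreUltraproduct

section Metric

variable {M : I → Type*} [∀ i, PseudoMetricSpace (M i)] {o : ∀ i, M i}

/-- The pseudometric `d((x_i), (y_i)) = lim_U d_i(x_i, y_i)`. -/
instance : Dist (PreUltraproduct U M o) where
  dist x y := limUnder (U : Filter I) fun i => dist (x.1 i) (y.1 i)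

theorem tendsto_dist (x y : PreUltraproduct U M o) :
    Tendsto (fun i => dist (x.1 i) (y.1 i)) U (𝓝 (dist x y)) := by
  obtain ⟨C, hC⟩ := x.2
  obtain ⟨D, hD⟩ := y.2
  refine Ultrafilter.tendsto_limUnder_of_bounded (C := C + D) fun i => ?_
  rw [abs_of_nonneg dist_nonneg]
  exact (dist_triangle_right _ _ (o i)).trans (add_le_add (hC i) (hD i))

instance : PseudoMetricSpace (PreUltraproduct U M o) where
  dist_self x := tendsto_nhds_unique (tendsto_dist x x) (by simp)
  dist_comm x y := tendsto_nhds_unique (tendsto_dist x y)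
    (by simpa only [dist_comm] using tendsto_dist y x)
  dist_triangle x y z := le_of_tendsto_of_tendsto' (tendsto_dist x z)
    ((tendsto_dist x y).add (tendsto_dist y z)) fun _ => dist_triangle _ _ _

end Metric

section Normed

variable {E : I → Type*} [∀ i, NormedAddCommGroup (E i)]

theorem exists_norm_le (x : PreUltraproduct U E fun _ => 0) : ∃ C : ℝ, ∀ i, ‖x.1 i‖ ≤ C := by
  simpa only [dist_zero_right] using x.2

variable [∀ i, NormedSpace ℝ (E i)]

/-- The bounded families as a linear subspace of the product. -/
def boundedSubmodule (E : I → Type*) [∀ i, NormedAddCommGroup (E i)]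
    [∀ i, NormedSpace ℝ (E i)] : Submodule ℝ (∀ i, E i) where
  carrier := {x | ∃ C : ℝ, ∀ i, dist (x i) 0 ≤ C}
  zero_mem' := ⟨0, fun i => by simp⟩
  add_mem' := by
    rintro x y ⟨C, hC⟩ ⟨D, hD⟩
    simp only [dist_zero_right] at hC hD
    exact ⟨C + D, fun i => by
      simpa using (norm_add_le (x i) (y i)).trans (add_le_add (hC i) (hD i))⟩
  smul_mem' := by
    rintro c x ⟨C, hC⟩
    simp only [dist_zero_right] at hC
    exact ⟨‖c‖ * C, fun i => by
      simpa [norm_smul] using mul_le_mul_of_nonneg_left (hC i) (norm_nonneg c)⟩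

instance : AddCommGroup (PreUltraproduct U E fun _ => 0) :=
  inferInstanceAs (AddCommGroup (boundedSubmodule E))

instance : Module ℝ (PreUltraproduct U E fun _ => 0) :=
  inferInstanceAs (Module ℝ (boundedSubmodule E))

@[simp] theorem zero_val (i : I) : (0 : PreUltraproduct U E fun _ => 0).1 i = 0 := rfl
@[simp] theorem add_val (x y : PreUltraproduct U E fun _ => 0) (i : I) :
    (x + y).1 i = x.1 i + y.1 i := rfl
@[simp] theorem neg_val (x : PreUltraproduct U E fun _ => 0) (i : I) : (-x).1 i = -x.1 i := rfl
@[simp] theorem sub_val (x y : PreUltraproduct U E fun _ => 0) (i : I) :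
    (x - y).1 i = x.1 i - y.1 i := rfl
@[simp] theorem smul_val (c : ℝ) (x : PreUltraproduct U E fun _ => 0) (i : I) :
    (c • x).1 i = c • x.1 i := rfl

/-- The seminorm `lim_U ‖x_i‖`, written as the distance to `0`. -/
instance : SeminormedAddCommGroup (PreUltraproduct U E fun _ => 0) where
  norm x := dist x 0
  dist_eq x y := by
    refine congrArg (limUnder (U : Filter I)) (funext fun i => ?_)
    simp [dist_eq_norm, ← sub_eq_neg_add, norm_sub_rev]

theorem tendsto_norm (x : PreUltraproduct U E fun _ => 0) :
    Tendsto (fun i => ‖x.1 i‖) U (𝓝 ‖x‖) := by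
  simpa only [zero_val, dist_zero_right] using tendsto_dist x 0

instance : NormedSpace ℝ (PreUltraproduct U E fun _ => 0) where
  norm_smul_le c x := le_of_eq <| tendsto_nhds_unique (tendsto_norm (c • x)) <| by
    simpa only [smul_val, norm_smul] using (tendsto_norm x).const_mul ‖c‖

end Normed

end PreUltraproduct

/-- The ultraproduct `(M_i)_U` of pointed metric spaces: the quotient of `ℓ_∞(M_i)` that
identifies families at distance `0`. For normed spaces with distinguished points `0`, it is the
ultraproduct of normed spaces. -/
abbrev Ultraproduct {I : Type*} (U : Ultrafilter I) (M : I → Type*) [∀ i, PseudoMetricSpace (M i)]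
    (o : ∀ i, M i) : Type _ :=
  SeparationQuotient (PreUltraproduct U M o)

end Ultraproduct

/-! ### The algebra `(Lip₀(M_i))_U` of a uniformly bounded family -/

section LipUltraproduct

/-- The metric spaces `M_i` are uniformly bounded. -/
class UniformlyBounded {I : Type*} (M : I → Type*) [∀ i, MetricSpace (M i)] : Prop where
  exists_dist_le : ∃ D : ℝ, ∀ i, ∀ x y : M i, dist x y ≤ D

/-- Bounded families of elements of `Lip₀(M_i)`. -/
abbrev PreLipUltraproduct {I : Type*} (U : Ultrafilter I) (M : I → Type*) [∀ i, MetricSpace (M i)]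
    (o : ∀ i, M i) : Type _ :=
  PreUltraproduct U (fun i => Lip0 (M i) (o i)) fun _ => 0

/-- The ultraproduct `(Lip₀(M_i))_U` of normed spaces. -/
abbrev LipUltraproduct {I : Type*} (U : Ultrafilter I) (M : I → Type*) [∀ i, MetricSpace (M i)]
    (o : ∀ i, M i) : Type _ :=
  Ultraproduct U (fun i => Lip0 (M i) (o i)) fun _ => 0

variable {I : Type*} {U : Ultrafilter I} {M : I → Type*} [∀ i, MetricSpace (M i)] {o : ∀ i, M i}

/-- The coordinatewise product `(f_i)(g_i) = (f_i g_i)`; it passes to the quotient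
`(Lip₀(M_i))_U` because it is continuous. -/
instance [hM : UniformlyBounded M] : Mul (PreLipUltraproduct U M o) where
  mul f g := ⟨fun i => Lip0.mulOfBounded (hM.exists_dist_le.choose_spec i) (f.1 i) (g.1 i), by
    obtain ⟨A, hA⟩ := PreUltraproduct.exists_norm_le f
    obtain ⟨B, hB⟩ := PreUltraproduct.exists_norm_le g
    refine ⟨2 * |hM.exists_dist_le.choose| * A * B, fun i => ?_⟩
    rw [dist_zero_right]
    have hA0 : 0 ≤ A := (norm_nonneg _).trans (hA i)
    refine (Lip0.norm_mulOfBounded_le _ _ _).trans ?_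
    gcongr
    · exact le_abs_self _
    · exact hA i
    · exact hB i⟩

theorem PreLipUltraproduct.mul_val_apply [UniformlyBounded M] (f g : PreLipUltraproduct U M o)
    (i : I) (x : M i) : (f * g).1 i x = f.1 i x * g.1 i x := rfl

instance [UniformlyBounded M] : NonUnitalCommRing (PreLipUltraproduct U M o) where
  left_distrib f g h := Subtype.ext <| funext fun i => Lip0.ext fun x =>
    mul_add (f.1 i x) (g.1 i x) (h.1 i x)
  right_distrib f g h := Subtype.ext <| funext fun i => Lip0.ext fun x =>
    add_mul (f.1 i x) (g.1 i x) (h.1 i x)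
  zero_mul f := Subtype.ext <| funext fun i => Lip0.ext fun x => zero_mul (f.1 i x)
  mul_zero f := Subtype.ext <| funext fun i => Lip0.ext fun x => mul_zero (f.1 i x)
  mul_assoc f g h := Subtype.ext <| funext fun i => Lip0.ext fun x =>
    mul_assoc (f.1 i x) (g.1 i x) (h.1 i x)
  mul_comm f g := Subtype.ext <| funext fun i => Lip0.ext fun x => mul_comm (f.1 i x) (g.1 i x)

theorem PreLipUltraproduct.exists_norm_mul_le (U : Ultrafilter I) (M : I → Type*)
    [∀ i, MetricSpace (M i)] (o : ∀ i, M i) [hM : UniformlyBounded M] :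
    ∃ C : ℝ, ∀ f g : PreLipUltraproduct U M o, ‖f * g‖ ≤ C * ‖f‖ * ‖g‖ :=
  ⟨2 * hM.exists_dist_le.choose, fun f g =>
    le_of_tendsto_of_tendsto' (PreUltraproduct.tendsto_norm (f * g))
      (((PreUltraproduct.tendsto_norm f).const_mul (2 * hM.exists_dist_le.choose)).mul
        (PreUltraproduct.tendsto_norm g))
      fun i => Lip0.norm_mulOfBounded_le (hM.exists_dist_le.choose_spec i) (f.1 i) (g.1 i)⟩

instance [UniformlyBounded M] : ContinuousMul (PreLipUltraproduct U M o) where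
  continuous_mul := by
    obtain ⟨C, hC⟩ := PreLipUltraproduct.exists_norm_mul_le U M o
    refine continuous_iff_continuousAt.2 fun ⟨a, b⟩ => ?_
    rw [ContinuousAt, tendsto_iff_norm_sub_tendsto_zero]
    have ha : Tendsto (fun p : PreLipUltraproduct U M o × PreLipUltraproduct U M o => ‖p.1 - a‖)
        (𝓝 (a, b)) (𝓝 0) :=
      tendsto_iff_norm_sub_tendsto_zero.1 continuous_fst.continuousAt
    have hb : Tendsto (fun p : PreLipUltraproduct U M o × PreLipUltraproduct U M o => ‖p.2 - b‖)
        (𝓝 (a, b)) (𝓝 0) :=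
      tendsto_iff_norm_sub_tendsto_zero.1 continuous_snd.continuousAt
    have hn : Tendsto (fun p : PreLipUltraproduct U M o × PreLipUltraproduct U M o => ‖p.2‖)
        (𝓝 (a, b)) (𝓝 ‖b‖) := continuous_snd.norm.continuousAt
    have hlim : Tendsto (fun p : PreLipUltraproduct U M o × PreLipUltraproduct U M o =>
        C * ‖p.1 - a‖ * ‖p.2‖ + C * ‖a‖ * ‖p.2 - b‖) (𝓝 (a, b)) (𝓝 0) := by
      simpa using ((ha.const_mul C).mul hn).add (hb.const_mul (C * ‖a‖))
    refine squeeze_zero (fun _ => norm_nonneg _) (fun p => ?_) hlim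
    have hp : p.1 * p.2 - a * b = (p.1 - a) * p.2 + a * (p.2 - b) :=
      Subtype.ext <| funext fun i => Lip0.ext fun x =>
        show p.1.1 i x * p.2.1 i x - a.1 i x * b.1 i x =
          (p.1.1 i x - a.1 i x) * p.2.1 i x + a.1 i x * (p.2.1 i x - b.1 i x) by ring
    change ‖p.1 * p.2 - a * b‖ ≤ _
    rw [hp]
    exact (norm_add_le _ _).trans (add_le_add (hC _ _) (hC _ _))

instance [UniformlyBounded M] : IsTopologicalRing (PreLipUltraproduct U M o) where
  continuous_add := continuous_add
  continuous_neg := continuous_neg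

end LipUltraproduct

/-- `X` and `Y` are biLipschitz equivalent: there is a bijection between them that is Lipschitz
and has a Lipschitz inverse. -/
def BiLipschitzEquivalent (X Y : Type*) [MetricSpace X] [MetricSpace Y] : Prop :=
  ∃ e : X ≃ Y, ∃ A B : ℝ≥0, LipschitzWith A e ∧ LipschitzWith B e.symm

end

/-! A bounded family of points `x` defines the multiplicative functional `f ↦ lim_U f_i(x_i)` on
`(Lip₀(M_i))_U`. Transported by `R.symm`, it is a multiplicative functional on `Lip₀(K)`, hence
evaluation at some `φ x` because `K` is compact (`Lip0.exists_eq_apply_of_multiplicative`). So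
`lim_U f_i(x_i) = (R f)(φ x)`.

For a fixed function, this identity bounds differences of its values at `φ x` and `φ y` by a
multiple of `d(x, y)`, and differences of its limit values at `x` and `y` by a multiple of `d(φ x, φ
y)`. The multiples depend on norms after applying `R.symm` or `R`, neither of which is assumed
continuous. Uniform boundedness, applied to the differences of evaluations divided by the relevant
distance, makes them uniform on unit balls (`exists_abs_le_mul_norm_mul_of_pointwise`); this is why
both function spaces must be complete. Testing against distance functions then gives the two
Lipschitz estimates. -/

namespace Lip0

/-! ### Completeness and multiplicative functionals of `Lip₀` -/

variable {M : Type*} [MetricSpace M] {o : M}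

theorem lipschitzWith (f : Lip0 M o) : LipschitzWith ‖f‖₊ f :=
  LipschitzWith.of_dist_le_mul f.abs_sub_le

/-- A function that vanishes at the base point and has bounded slopes, as an element of
`Lip₀(M)`. -/
def mk (f : M → ℝ) (C : ℝ) (h0 : f o = 0) (h : ∀ x y, |f x - f y| ≤ C * dist x y) : Lip0 M o :=
  ⟨f, h0, C.toNNReal, LipschitzWith.of_dist_le_mul fun x y =>
    (h x y).trans (mul_le_mul_of_nonneg_right (Real.le_coe_toNNReal C) dist_nonneg)⟩

@[simp] theorem mk_apply (f : M → ℝ) (C : ℝ) (h0 : f o = 0)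
    (h : ∀ x y, |f x - f y| ≤ C * dist x y) (x : M) : mk f C h0 h x = f x := rfl

/-- The distance to `y`, normalized to vanish at the base point. -/
def distFrom (o y : M) : Lip0 M o :=
  mk (fun x => dist x y - dist o y) 1 (sub_self _) fun x z => by
    simpa using abs_dist_sub_le x z y

@[simp] theorem distFrom_apply (y x : M) : distFrom o y x = dist x y - dist o y := rfl

theorem norm_distFrom_le (y : M) : ‖distFrom o y‖ ≤ 1 :=
  norm_le zero_le_one fun x z => by simpa using abs_dist_sub_le x z y

/-- Evaluation at a point, as a continuous linear functional. -/
noncomputable def eval (x : M) : Lip0 M o →L[ℝ] ℝ :=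
  LinearMap.mkContinuous
    { toFun := fun f => f x
      map_add' := fun _ _ => rfl
      map_smul' := fun _ _ => rfl } (dist x o) fun f => by
    rw [mul_comm]; exact f.abs_apply_le x

@[simp] theorem eval_apply (x : M) (f : Lip0 M o) : eval x f = f x := rfl

/-- Evaluations are continuous, so a Cauchy sequence converges pointwise; slope bounds survive
pointwise limits, which puts the limit in `Lip₀` and gives convergence in norm. -/
instance : CompleteSpace (Lip0 M o) := by
  refine Metric.complete_of_cauchySeq_tendsto fun u hu => ?_
  have hpt : ∀ x, ∃ a, Tendsto (fun n => u n x) atTop (𝓝 a) := fun x =>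
    cauchySeq_tendsto_of_complete ((eval x).uniformContinuous.comp_cauchySeq hu)
  choose f hf using hpt
  obtain ⟨B, -, hB⟩ := cauchySeq_bdd hu
  have h0 : f o = 0 := tendsto_nhds_unique (hf o) (by simp)
  have hlip : ∀ x y, |f x - f y| ≤ (‖u 0‖ + B) * dist x y := fun x y => by
    refine le_of_tendsto ((hf x).sub (hf y)).abs (Eventually.of_forall fun n => ?_)
    refine ((u n).abs_sub_le x y).trans (mul_le_mul_of_nonneg_right ?_ dist_nonneg)
    have h1 := norm_le_norm_add_norm_sub (u 0) (u n)
    have h2 := hB 0 n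
    rw [dist_eq_norm] at h2
    linarith
  refine ⟨mk f _ h0 hlip, Metric.tendsto_atTop.2 fun ε hε => ?_⟩
  obtain ⟨N, hN⟩ := Metric.cauchySeq_iff.1 hu (ε / 2) (half_pos hε)
  refine ⟨N, fun n hn => ?_⟩
  rw [dist_eq_norm]
  -- Passing to the limit in `m` keeps only a weak inequality; using `ε / 2` recovers the strict
  -- one.
  refine lt_of_le_of_lt (norm_le (half_pos hε).le fun x y => ?_) (half_lt_self hε)
  have hlim : Tendsto (fun m => |(u n x - u m x) - (u n y - u m y)|) atTop
      (𝓝 |(u n x - f x) - (u n y - f y)|) :=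
    ((tendsto_const_nhds.sub (hf x)).sub (tendsto_const_nhds.sub (hf y))).abs
  refine le_of_tendsto hlim (eventually_atTop.2 ⟨N, fun m hm => ?_⟩)
  refine ((u n - u m).abs_sub_le x y).trans (mul_le_mul_of_nonneg_right ?_ dist_nonneg)
  rw [← dist_eq_norm]
  exact (hN n hn m hm).le

/-- If `s + c` is bounded below by a positive constant, `Lip₀(M)` contains the quotients by it. -/
theorem exists_mul_add_smul_eq [BoundedSpace M] (e s : Lip0 M o) (c : ℝ) {ε : ℝ} (hε : 0 < ε)
    (hs : ∀ x, ε ≤ s x + c) : ∃ t : Lip0 M o, t * s + c • t = e := by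
  obtain ⟨D, hD⟩ := exists_dist_le M
  have hbd : ∀ (g : Lip0 M o) x, |g x| ≤ ‖g‖ * D := fun g x =>
    (g.abs_apply_le x).trans (mul_le_mul_of_nonneg_left (hD _ _) (norm_nonneg _))
  have hD0 : 0 ≤ D := dist_nonneg.trans (hD o o)
  have hpos : ∀ x, 0 < s x + c := fun x => hε.trans_le (hs x)
  -- The constant is the quotient rule estimate: values are at most norm times `D`, and the product
  -- of the denominators is at least `ε ^ 2`.
  refine ⟨mk (fun x => e x / (s x + c))
    ((‖e‖ * (‖s‖ * D + |c|) + ‖e‖ * D * ‖s‖) / ε ^ 2) (by simp) fun x y => ?_, ?_⟩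
  · have hxy : e x / (s x + c) - e y / (s y + c) =
        ((e x - e y) * (s y + c) - e y * (s x - s y)) / ((s x + c) * (s y + c)) := by
      have := (hpos x).ne'
      have := (hpos y).ne'
      field_simp
      ring
    have hnum : |(e x - e y) * (s y + c) - e y * (s x - s y)| ≤
        (‖e‖ * (‖s‖ * D + |c|) + ‖e‖ * D * ‖s‖) * dist x y := by
      calc _ ≤ |(e x - e y) * (s y + c)| + |e y * (s x - s y)| := abs_sub _ _
        _ = |e x - e y| * |s y + c| + |e y| * |s x - s y| := by rw [abs_mul, abs_mul]
        _ ≤ (‖e‖ * dist x y) * (‖s‖ * D + |c|) + (‖e‖ * D) * (‖s‖ * dist x y) := by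
          gcongr
          · exact e.abs_sub_le x y
          · exact (abs_add_le _ _).trans (by gcongr; exact hbd s y)
          · exact hbd e y
          · exact s.abs_sub_le x y
        _ = _ := by ring
    have hden : ε ^ 2 ≤ (s x + c) * (s y + c) := by
      rw [sq]; exact mul_le_mul (hs x) (hs y) hε.le (hpos x).le
    rw [hxy, abs_div, abs_of_pos (mul_pos (hpos x) (hpos y)), div_mul_eq_mul_div]
    exact div_le_div₀ ((abs_nonneg _).trans hnum) hnum (by positivity) hden
  · ext x
    have := (hpos x).ne'
    simp only [add_apply, mul_apply, smul_apply, mk_apply]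
    field_simp

/-- On a compact space, every multiplicative linear functional on `Lip₀(K)` is the evaluation at a
point. -/
theorem exists_eq_apply_of_multiplicative {K : Type*} [MetricSpace K] [CompactSpace K] {k₀ : K}
    (χ : Lip0 K k₀ →ₗ[ℝ] ℝ) (hχ : ∀ f g, χ (f * g) = χ f * χ g) :
    ∃ k : K, ∀ f, χ f = f k := by
  by_cases h0 : ∀ f, χ f = 0
  · exact ⟨k₀, fun f => by simp [h0 f]⟩
  push Not at h0
  obtain ⟨e, he⟩ := h0
  -- Each condition defines a closed set, so finitely many functions at a time suffice.
  have hne : (Set.univ ∩ ⋂ f : Lip0 K k₀, {k | χ f = f k}).Nonempty := by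
    refine isCompact_univ.inter_iInter_nonempty _
      (fun f => isClosed_eq continuous_const f.lipschitzWith.continuous) fun T => ?_
    by_contra hT
    -- Without a unit, `∑ (g - χ g)²` is split into `s` in the algebra and the constant `c`. The sum
    -- is positive on `K` if `T` has no common point, while the unital extension of `χ` kills it.
    set s : Lip0 K k₀ := ∑ g ∈ T, (g * g - (2 * χ g) • g) with hsdef
    set c : ℝ := ∑ g ∈ T, χ g ^ 2 with hcdef
    have hsx : ∀ x, s x + c = ∑ g ∈ T, (g x - χ g) ^ 2 := fun x => by
      have : s x = ∑ g ∈ T, (g * g - (2 * χ g) • g) x := map_sum (eval x) _ _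
      rw [this, hcdef, ← Finset.sum_add_distrib]
      refine Finset.sum_congr rfl fun g _ => ?_
      simp only [sub_apply, mul_apply, smul_apply]
      ring
    have hχs : χ s = -c := by
      rw [hsdef, hcdef, map_sum, ← Finset.sum_neg_distrib]
      refine Finset.sum_congr rfl fun g _ => ?_
      rw [map_sub, hχ, map_smul, smul_eq_mul]
      ring
    have hpos : ∀ x, 0 < s x + c := fun x => by
      rw [hsx]
      refine (Finset.sum_nonneg fun g _ => sq_nonneg _).lt_of_ne fun h => hT ⟨x, trivial, ?_⟩
      have hz := (Finset.sum_eq_zero_iff_of_nonneg fun g _ => sq_nonneg (g x - χ g)).1 h.symm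
      simp only [Set.mem_iInter, Set.mem_ofPred_eq]
      exact fun g hg => (sub_eq_zero.1 (pow_eq_zero_iff two_ne_zero |>.1 (hz g hg))).symm
    obtain ⟨m, -, hm⟩ := isCompact_univ.exists_isMinOn ⟨k₀, Set.mem_univ k₀⟩
      (s.lipschitzWith.continuous.add continuous_const : Continuous fun x => s x + c).continuousOn
    -- The positive minimum allows division by `s + c`, so `e` is a multiple of an element killed by
    -- `χ`, contradicting `χ e ≠ 0`.
    obtain ⟨t, ht⟩ := exists_mul_add_smul_eq e s c (hpos m) fun x => hm (Set.mem_univ x)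
    apply he
    rw [← ht, map_add, hχ, map_smul, hχs, smul_eq_mul]
    ring
  obtain ⟨k, -, hk⟩ := hne
  exact ⟨k, by simpa using hk⟩

end Lip0

/-! ### Completeness of bounded families -/

/-- A seminormed group is complete if every absolutely convergent series converges. -/
theorem SeminormedAddCommGroup.completeSpace_of_summable_imp_tendsto {E : Type*}
    [SeminormedAddCommGroup E]
    (h : ∀ u : ℕ → E, Summable (fun n => ‖u n‖) →
      ∃ a, Tendsto (fun n => ∑ i ∈ Finset.range n, u i) atTop (𝓝 a)) :
    CompleteSpace E := by
  refine SeparationQuotient.completeSpace_iff.1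
    (NormedAddCommGroup.completeSpace_of_summable_imp_tendsto fun u hu => ?_)
  choose rep hrep using SeparationQuotient.surjective_mk (X := E)
  have hnorm : ∀ n, ‖rep (u n)‖ = ‖u n‖ := fun n => by
    rw [← SeparationQuotient.norm_mk (rep (u n)), hrep]
  obtain ⟨a, ha⟩ := h (fun n => rep (u n)) (by simpa only [hnorm] using hu)
  refine ⟨SeparationQuotient.mk a, ?_⟩
  have hmk : ∀ n, SeparationQuotient.mk (∑ i ∈ Finset.range n, rep (u i)) =
      ∑ i ∈ Finset.range n, u i := fun n => by
    rw [← SeparationQuotient.mkAddMonoidHom_apply, map_sum]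
    exact Finset.sum_congr rfl fun i _ => hrep (u i)
  exact ((SeparationQuotient.continuous_mk.tendsto a).comp ha).congr hmk

/-- A family of Banach spaces has a complete space of bounded families, for the seminorm given by
the limit along an ultrafilter. -/
instance PreUltraproduct.instCompleteSpace {I : Type*} {U : Ultrafilter I} {E : I → Type*}
    [∀ i, NormedAddCommGroup (E i)] [∀ i, NormedSpace ℝ (E i)] [∀ i, CompleteSpace (E i)] :
    CompleteSpace (PreUltraproduct U E fun _ => 0) := by
  classical
  refine SeminormedAddCommGroup.completeSpace_of_summable_imp_tendsto fun u hu => ?_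
  -- The summable slack makes `‖(u n).1 i‖ ≤ a n` hold for `U`-almost all `i`, although the norms
  -- only converge to `‖u n‖`.
  set a : ℕ → ℝ := fun n => ‖u n‖ + (1 / 2) ^ n
  have ha : Summable a := hu.add summable_geometric_two
  have ha0 : ∀ n, 0 ≤ a n := fun n => by positivity
  have hS : ∀ n, ∀ᶠ i in (U : Filter I), ‖(u n).1 i‖ ≤ a n := fun n =>
    ((tendsto_norm (u n)).eventually_lt_const
      (lt_add_of_pos_right ‖u n‖ (by positivity : (0 : ℝ) < (1 / 2) ^ n))).mono fun _ => le_of_lt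
  -- Truncation makes the series converge absolutely in every coordinate. Comparing a partial sum
  -- with the limit involves only finitely many truncations, so no countable completeness of `U` is
  -- needed.
  let v : ℕ → ∀ i, E i := fun n i => if ‖(u n).1 i‖ ≤ a n then (u n).1 i else 0
  have hv : ∀ n i, ‖v n i‖ ≤ a n := fun n i => by
    by_cases h : ‖(u n).1 i‖ ≤ a n
    · simp [v, h]
    · simp [v, h, ha0 n]
  have hvs : ∀ i, Summable fun n => v n i := fun i => .of_norm_bounded ha fun n => hv n i
  let s : PreUltraproduct U E fun _ => 0 := ⟨fun i => ∑' n, v n i, ∑' n, a n, fun i => by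
    rw [dist_zero_right]; exact tsum_of_norm_bounded ha.hasSum fun n => hv n i⟩
  refine ⟨s, tendsto_iff_norm_sub_tendsto_zero.2 ?_⟩
  refine squeeze_zero (fun _ => norm_nonneg _) (fun N => ?_) (_root_.tendsto_sum_nat_add a)
  refine le_of_tendsto (tendsto_norm _) ?_
  have hSN : ∀ᶠ i in (U : Filter I), ∀ n ∈ Finset.range N, ‖(u n).1 i‖ ≤ a n :=
    (Filter.eventually_all_finset _).2 fun n _ => hS n
  refine hSN.mono fun i hi => ?_
  have hsum : (∑ n ∈ Finset.range N, u n).1 i = ∑ n ∈ Finset.range N, v n i := by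
    have h1 : (∑ n ∈ Finset.range N, u n).1 i = ∑ n ∈ Finset.range N, (u n).1 i :=
      map_sum (AddMonoidHom.mk' (fun x : PreUltraproduct U E fun _ => 0 => x.1 i)
        fun _ _ => rfl) _ _
    rw [h1]
    exact Finset.sum_congr rfl fun n hn => by simp only [v, if_pos (hi n hn)]
  have htail : (∑ n ∈ Finset.range N, v n i) - s.1 i = -∑' n, v (n + N) i := by
    change _ - ∑' n, v n i = _
    rw [← (hvs i).sum_add_tsum_nat_add N]
    abel
  rw [sub_val, hsum, htail, norm_neg]
  exact tsum_of_norm_bounded ((summable_nat_add_iff N).2 ha).hasSum fun n => hv _ i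

/-! ### Evaluation functionals on the ultraproduct -/

namespace PreLipUltraproduct

variable {I : Type*} {U : Ultrafilter I} {M : I → Type*} [∀ i, MetricSpace (M i)] {o : ∀ i, M i}

/-- The value `lim_U f_i(x_i)` of a bounded family of functions at a bounded family of points. -/
noncomputable def value (f : PreLipUltraproduct U M o) (x : PreUltraproduct U M o) : ℝ :=
  limUnder (U : Filter I) fun i => f.1 i (x.1 i)

theorem tendsto_value (f : PreLipUltraproduct U M o) (x : PreUltraproduct U M o) :
    Tendsto (fun i => f.1 i (x.1 i)) U (𝓝 (value f x)) := by
  obtain ⟨A, hA⟩ := PreUltraproduct.exists_norm_le f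
  obtain ⟨C, hC⟩ := x.2
  refine Ultrafilter.tendsto_limUnder_of_bounded (C := A * C) fun i => ?_
  exact ((f.1 i).abs_apply_le _).trans
    (mul_le_mul (hA i) (hC i) dist_nonneg ((norm_nonneg _).trans (hA i)))

theorem value_add (f g : PreLipUltraproduct U M o) (x : PreUltraproduct U M o) :
    value (f + g) x = value f x + value g x :=
  tendsto_nhds_unique (tendsto_value (f + g) x) ((tendsto_value f x).add (tendsto_value g x))

theorem value_smul (c : ℝ) (f : PreLipUltraproduct U M o) (x : PreUltraproduct U M o) :
    value (c • f) x = c * value f x :=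
  tendsto_nhds_unique (tendsto_value (c • f) x) ((tendsto_value f x).const_mul c)

theorem value_mul [UniformlyBounded M] (f g : PreLipUltraproduct U M o)
    (x : PreUltraproduct U M o) : value (f * g) x = value f x * value g x :=
  tendsto_nhds_unique (tendsto_value (f * g) x) ((tendsto_value f x).mul (tendsto_value g x))

theorem abs_value_sub_le (f : PreLipUltraproduct U M o) (x y : PreUltraproduct U M o) :
    |value f x - value f y| ≤ ‖f‖ * dist x y :=
  le_of_tendsto_of_tendsto' ((tendsto_value f x).sub (tendsto_value f y)).abs
    ((PreUltraproduct.tendsto_norm f).mul (PreUltraproduct.tendsto_dist x y))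
    fun i => (f.1 i).abs_sub_le _ _

/-- The distinguished point of the ultraproduct. -/
def base (U : Ultrafilter I) (o : ∀ i, M i) : PreUltraproduct U M o := ⟨o, 0, by simp⟩

theorem value_base (f : PreLipUltraproduct U M o) : value f (base U o) = 0 :=
  tendsto_nhds_unique (tendsto_value f _) (by simp [base])

/-- Evaluation at a bounded family of points, as a continuous linear functional. -/
noncomputable def eval (x : PreUltraproduct U M o) : PreLipUltraproduct U M o →L[ℝ] ℝ :=
  LinearMap.mkContinuous
    { toFun := fun f => value f x
      map_add' := fun f g => value_add f g x
      map_smul' := fun c f => value_smul c f x } (dist x (base U o)) fun f => by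
    have h := abs_value_sub_le f x (base U o)
    rw [value_base, sub_zero, mul_comm] at h
    exact h

@[simp] theorem eval_apply (x : PreUltraproduct U M o) (f : PreLipUltraproduct U M o) :
    eval x f = value f x := rfl

/-- Evaluation at a bounded family of points, on the ultraproduct `(Lip₀(M_i))_U`. -/
noncomputable def evalQuotient (x : PreUltraproduct U M o) : LipUltraproduct U M o →L[ℝ] ℝ :=
  SeparationQuotient.liftCLM (eval x) fun _ _ h => (h.map (eval x).continuous).eq

@[simp] theorem evalQuotient_mk (x : PreUltraproduct U M o) (f : PreLipUltraproduct U M o) :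
    evalQuotient x (SeparationQuotient.mk f) = value f x := rfl

theorem evalQuotient_mul [UniformlyBounded M] (x : PreUltraproduct U M o)
    (f g : LipUltraproduct U M o) :
    evalQuotient x (f * g) = evalQuotient x f * evalQuotient x g := by
  obtain ⟨f, rfl⟩ := SeparationQuotient.surjective_mk f
  obtain ⟨g, rfl⟩ := SeparationQuotient.surjective_mk g
  exact value_mul f g x

/-- The family of the functions `d(·, y_i) - d(o_i, y_i)`. -/
def distFrom (y : PreUltraproduct U M o) : PreLipUltraproduct U M o :=
  ⟨fun i => Lip0.distFrom (o i) (y.1 i), 1, fun i => by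
    rw [dist_zero_right]; exact Lip0.norm_distFrom_le _⟩

theorem norm_distFrom_le (y : PreUltraproduct U M o) : ‖distFrom y‖ ≤ 1 :=
  le_of_tendsto' (PreUltraproduct.tendsto_norm _) fun _ => Lip0.norm_distFrom_le _

/-- The normalizing constants cancel coordinatewise. With norm at most `1`, these are the test
functions for the lower Lipschitz estimate. -/
theorem value_distFrom_sub (x y : PreUltraproduct U M o) :
    value (distFrom y) x - value (distFrom y) y = dist x y :=
  tendsto_nhds_unique ((tendsto_value (distFrom y) x).sub (tendsto_value (distFrom y) y))
    (by simpa [distFrom] using PreUltraproduct.tendsto_dist x y)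

end PreLipUltraproduct

/-! ### Uniform boundedness and the biLipschitz embedding -/

/-- A pointwise bound for a family of functionals by weights is uniform on the unit ball. -/
theorem exists_abs_le_mul_norm_mul_of_pointwise {ι E : Type*} [SeminormedAddCommGroup E]
    [NormedSpace ℝ E] [CompleteSpace E] (T : ι → E →L[ℝ] ℝ) (w : ι → ℝ) (hw : ∀ i, 0 ≤ w i)
    (b : E → ℝ) (h : ∀ x i, |T i x| ≤ b x * w i) :
    ∃ C : ℝ≥0, ∀ i x, |T i x| ≤ C * ‖x‖ * w i := by
  -- Where `w i = 0` the scaled functional is `0`, and `T i` itself vanishes by `h`. The absolute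
  -- value supplies the nonnegative bound that this case needs.
  obtain ⟨C, hC⟩ := banach_steinhaus (g := fun i => (w i)⁻¹ • T i) fun x => ⟨|b x|, fun i => by
    rw [smul_apply, norm_smul, norm_inv, Real.norm_of_nonneg (hw i),
      Real.norm_eq_abs, inv_mul_eq_div]
    exact div_le_of_le_mul₀ (hw i) (abs_nonneg _)
      ((h x i).trans (mul_le_mul_of_nonneg_right (le_abs_self _) (hw i)))⟩
  refine ⟨C.toNNReal, fun i x => ?_⟩
  rcases (hw i).eq_or_lt with h0 | h0
  · simpa [← h0] using h x i
  · have hle := ((w i)⁻¹ • T i).le_of_opNorm_le ((hC i).trans (Real.le_coe_toNNReal C)) x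
    rw [smul_apply, norm_smul, norm_inv, Real.norm_of_nonneg h0.le,
      Real.norm_eq_abs, inv_mul_eq_div] at hle
    exact (div_le_iff₀ h0).1 hle

theorem mainTheorem12 {I : Type*} (U : Ultrafilter I)
    (M : I → Type*) [∀ i, MetricSpace (M i)] [UniformlyBounded M] (o : ∀ i, M i)
    (K : Type*) [MetricSpace K] [CompactSpace K] (k₀ : K)
    (R : LipUltraproduct U M o ≃ₗ[ℝ] Lip0 K k₀)
    (hR : ∀ f g : LipUltraproduct U M o, R (f * g) = R f * R g) :
    ∃ S : Set K, BiLipschitzEquivalent (Ultraproduct U M o) S := by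
  have hsymm : ∀ f g, R.symm (f * g) = R.symm f * R.symm g := fun f g => by
    rw [LinearEquiv.symm_apply_eq, hR, R.apply_symm_apply, R.apply_symm_apply]
  have hpoint : ∀ x : PreUltraproduct U M o, ∃ k : K, ∀ g : Lip0 K k₀,
      PreLipUltraproduct.evalQuotient x (R.symm g) = g k := fun x =>
    Lip0.exists_eq_apply_of_multiplicative
      ((PreLipUltraproduct.evalQuotient x).toLinearMap ∘ₗ R.symm.toLinearMap) fun f g =>
        (congrArg _ (hsymm f g)).trans (PreLipUltraproduct.evalQuotient_mul x _ _)
  choose φ hφ using hpoint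
  have hvalue : ∀ (f : PreLipUltraproduct U M o) (x),
      f.value x = R (SeparationQuotient.mk f) (φ x) := fun f x => by
    rw [← hφ, R.symm_apply_apply, PreLipUltraproduct.evalQuotient_mk]
  obtain ⟨A, hA⟩ := exists_abs_le_mul_norm_mul_of_pointwise
    (fun p : PreUltraproduct U M o × PreUltraproduct U M o =>
      (Lip0.eval (φ p.1) - Lip0.eval (φ p.2) : Lip0 K k₀ →L[ℝ] ℝ))
    (fun p => dist p.1 p.2) (fun _ => dist_nonneg) (fun g => ‖(R.symm g)‖) fun g p => by
      obtain ⟨f, hf⟩ := SeparationQuotient.surjective_mk (R.symm g)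
      have hg : R (SeparationQuotient.mk f) = g := by rw [hf, R.apply_symm_apply]
      have h := PreLipUltraproduct.abs_value_sub_le f p.1 p.2
      rw [hvalue, hvalue, hg] at h
      rw [← hf]
      exact h
  obtain ⟨B, hB⟩ := exists_abs_le_mul_norm_mul_of_pointwise
    (fun p : PreUltraproduct U M o × PreUltraproduct U M o =>
      PreLipUltraproduct.eval p.1 - PreLipUltraproduct.eval p.2)
    (fun p => dist (φ p.1) (φ p.2)) (fun _ => dist_nonneg)
    (fun f => ‖R (SeparationQuotient.mk f)‖) fun f p => by
      have h := (R (SeparationQuotient.mk f)).abs_sub_le (φ p.1) (φ p.2)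
      rwa [← hvalue, ← hvalue] at h
  have hupper : ∀ x y, dist (φ x) (φ y) ≤ A * dist x y := fun x y => by
    -- This test function has norm at most `1` and attains the full difference `d(φ x, φ y)`.
    have h := hA (x, y) (Lip0.distFrom k₀ (φ y))
    simp only [sub_apply, Lip0.eval_apply, Lip0.distFrom_apply, dist_self,
      sub_sub_sub_cancel_right, sub_zero, abs_dist] at h
    refine h.trans (mul_le_mul_of_nonneg_right ?_ dist_nonneg)
    exact mul_le_of_le_one_right A.2 (Lip0.norm_distFrom_le _)
  have hlower : ∀ x y, dist x y ≤ B * dist (φ x) (φ y) := fun x y => by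
    have h := hB (x, y) (PreLipUltraproduct.distFrom y)
    simp only [sub_apply, PreLipUltraproduct.eval_apply,
      PreLipUltraproduct.value_distFrom_sub, abs_dist] at h
    refine h.trans (mul_le_mul_of_nonneg_right ?_ dist_nonneg)
    exact mul_le_of_le_one_right B.2 (PreLipUltraproduct.norm_distFrom_le _)
  -- The quotient map is an isometry for the pseudometric, so both estimates hold for `φ` on any
  -- choice of representatives.
  choose rep hrep using SeparationQuotient.surjective_mk (X := PreUltraproduct U M o)
  have hdist : ∀ z w, dist z w = dist (rep z) (rep w) := fun z w => by
    rw [← SeparationQuotient.dist_mk (rep z), hrep, hrep]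
  have hlip : LipschitzWith A (φ ∘ rep) := LipschitzWith.of_dist_le_mul fun z w => by
    rw [hdist]; exact hupper _ _
  have hanti : AntilipschitzWith B (φ ∘ rep) := AntilipschitzWith.of_le_mul_dist fun z w => by
    rw [hdist]; exact hlower _ _
  refine ⟨Set.range (φ ∘ rep), Equiv.ofInjective _ hanti.injective, A, B,
    hlip, ?_⟩
  refine LipschitzWith.of_dist_le_mul fun s t => ?_
  obtain ⟨z, rfl⟩ := (Equiv.ofInjective _ hanti.injective).surjective s
  obtain ⟨w, rfl⟩ := (Equiv.ofInjective _ hanti.injective).surjective t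
  rw [Equiv.symm_apply_apply, Equiv.symm_apply_apply]
  exact hanti.le_mul_dist z w
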